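/- Let $\varphi:\mathbb R^3\to\mathbb R$ be smooth on $\mathbb R^3\setminus\{0\}$, positively homogeneous of degree one and positive away from the origin, and let $\Sigma=\{\varphi=1\}$. Suppose that near $v=(0,0,1)$ the surface $\Sigma$ is the graph $\xi_3=1+\phi(\xi_1,\xi_2)$ of a smooth function $\phi$ with $\phi(0,0)=0$, and that near the origin $$\phi(x_1,x_2)=b(x_1,x_2)\,(x_2-\psi(x_1))^2+b_0(x_1),$$ where $b,\psi,b_0$ are smooth, $b(0,0)\neq 0$, $\psi$ vanishes at $0$ to order $m$ and $b_0$ vanishes at $0$ to order $n$, with $m,n\in\{2,3,\dots\}\cup\{\infty\}$. (A smooth function $h$ vanishes at $0$ to finite order $N$ if $h(x)=x^N\beta(x)$ near $0$ with $\beta$ smooth and $\beta(0)\ne0$, and to order $\infty$ if all its derivatives vanish at $0$.) For a smooth function $a_k$ on $\mathbb R^3$ that is homogeneous of degree $-k$ for large $|\xi|$ put $M_k=F^{-1}[e^{i\varphi}a_k]F$, where $$Fu(\xi)=(2\pi)^{-3/2}\int e^{i\xi\cdot x}u(x)\,dx,\qquad F^{-1}w(x)=(2\pi)^{-3/2}\int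 e^{-i\xi\cdot x}w(\xi)\,d\xi .$$ Assume $2m\ge n$. Then for every real $k$ there is such an amplitude $a_k$, with $a_k(\xi)=|\xi|^{-k}$ for all large $|\xi|$, such that for every $p$ with $1\le p\le 2$, $\frac1p+\frac1{p'}=1$ and $$k<\Bigl(5-\frac2n\Bigr)\Bigl(\frac1p-\frac12\Bigr)\qquad(\text{where } 2/\infty=0)$$ the operator $M_k$ is not bounded from $L^p(\mathbb R^3)$ to $L^{p'}(\mathbb R^3)$, that is, there is no constant $C$ with $\|M_ku\|_{L^{p'}}\le C\|u\|_{L^p}$ for all Schwartz functions $u$. Moreover, for every real $k$ and every open conic neighbourhood $\Gamma$ of $v$ there is also an amplitude $a_k$ (smooth, homogeneous of degree $-k$ for large $|\xi|$) with support in $\Gamma$ for which $M_k$ is not bounded from $L^p(\mathbb R^3)$ to $L^{p'}(\mathbb R^3)$ for all these $p$. -/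

import Mathlib

open scoped ContDiff NNReal ENNReal

noncomputable section

namespace OscConv

/-- Three dimensional Euclidean space `ℝ³`. -/
abbrev E3 : Type := EuclideanSpace ℝ (Fin 3)

/-- The point `v = (0, 0, 1)`. -/
def northPole : E3 := !₂[(0 : ℝ), 0, 1]

/-- The Fourier transform `(2π)^{-3/2} ∫ e^{i ξ·x} u(x) dx`. -/
def fourierT (u : E3 → ℂ) (ξ : E3) : ℂ :=
  (1 / (Real.sqrt ((2 * Real.pi) ^ 3) : ℂ)) *
    ∫ x : E3, Complex.exp (Complex.I * (inner ℝ ξ x : ℝ)) * u x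

/-- The inverse Fourier transform `(2π)^{-3/2} ∫ e^{-i ξ·x} w(ξ) dξ`. -/
def fourierTInv (w : E3 → ℂ) (x : E3) : ℂ :=
  (1 / (Real.sqrt ((2 * Real.pi) ^ 3) : ℂ)) *
    ∫ ξ : E3, Complex.exp (-(Complex.I * (inner ℝ ξ x : ℝ))) * w ξ

/-- The convolution operator `M = F⁻¹ [e^{iφ} a] F` with phase `φ` and amplitude `a`. -/
def convOp (φ : E3 → ℝ) (a : E3 → ℂ) (u : E3 → ℂ) : E3 → ℂ :=
  fourierTInv fun ξ => Complex.exp (Complex.I * (φ ξ : ℝ)) * a ξ * fourierT u ξ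

/-- `F⁻¹ [e^{iφ} a] F` is bounded from `L^p(ℝ³)` to `L^q(ℝ³)`: it satisfies a norm inequality on
the Schwartz functions. -/
def IsLpLqBounded (φ : E3 → ℝ) (a : E3 → ℂ) (p q : ℝ≥0∞) : Prop :=
  ∃ C : ℝ≥0, ∀ u : SchwartzMap E3 ℂ,
    MeasureTheory.eLpNorm (convOp φ a u) q MeasureTheory.volume
      ≤ C * MeasureTheory.eLpNorm u p MeasureTheory.volume

/-- A phase: smooth away from the origin, positively homogeneous of degree one, and positive.
(The value at the origin plays no role.) -/
structure IsPhase (φ : E3 → ℝ) : Prop where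
  smooth : ContDiffOn ℝ ∞ φ {0}ᶜ
  homogeneous : ∀ t : ℝ, 0 < t → ∀ ξ : E3, ξ ≠ 0 → φ (t • ξ) = t * φ ξ
  pos : ∀ ξ : E3, ξ ≠ 0 → 0 < φ ξ

/-- An amplitude of order `-k`: smooth on `ℝ³`, and homogeneous of degree `-k` for large `ξ`. -/
structure IsAmplitude (k : ℝ) (a : E3 → ℂ) : Prop where
  smooth : ContDiff ℝ ∞ a
  homogeneous : ∃ R : ℝ, 0 < R ∧ ∀ ξ : E3, R ≤ ‖ξ‖ → ∀ t : ℝ, 1 ≤ t →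
    a (t • ξ) = ((t ^ (-k) : ℝ) : ℂ) * a ξ

/-- An open conic neighbourhood of the point `v`. -/
structure IsConicNhd (v : E3) (Γ : Set E3) : Prop where
  isOpen : IsOpen Γ
  mem : v ∈ Γ
  conic : ∀ ξ ∈ Γ, ∀ t : ℝ, 0 < t → t • ξ ∈ Γ

/-- Near `(0, 0, 1)` the surface `{φ = 1}` is the graph `ξ₃ = 1 + ϕ(ξ₁, ξ₂)` of a smooth `ϕ` with
`ϕ(0, 0) = 0`. (As `∂₃φ(0, 0, 1) = φ(0, 0, 1) = 1`, such a `ϕ` is unique near the origin.) -/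
def IsLocalGraph (φ : E3 → ℝ) (ϕ : ℝ × ℝ → ℝ) : Prop :=
  ϕ (0, 0) = 0 ∧ ∃ r : ℝ, 0 < r ∧
    ContDiffOn ℝ ∞ ϕ (Set.Ioo (-r) r ×ˢ Set.Ioo (-r) r) ∧
    ∀ y ∈ Set.Ioo (-r) r ×ˢ Set.Ioo (-r) r, φ !₂[y.1, y.2, 1 + ϕ y] = 1

/-- The order of vanishing `N ∈ ℕ ∪ {∞}` at `0` of a function `h` that is smooth near `0`:
for finite `N`, `h(x) = x ^ N * β(x)` near `0` with `β` smooth and `β(0) ≠ 0`; for `N = ∞`,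
`h` is flat at `0`. -/
def HasOrderAtZero (h : ℝ → ℝ) (N : ℕ∞) : Prop :=
  (∀ l : ℕ, N = l → ∃ r : ℝ, 0 < r ∧ ∃ β : ℝ → ℝ, ContDiffOn ℝ ∞ β (Set.Ioo (-r) r) ∧
    β 0 ≠ 0 ∧ ∀ x ∈ Set.Ioo (-r) r, h x = x ^ l * β x) ∧
  (N = ⊤ → ∀ l : ℕ, iteratedDeriv l h 0 = 0)

/-- The pair `(m, n)` is attached to `ϕ` at the origin: near the origin
`ϕ(x₁, x₂) = b(x₁, x₂) (x₂ - ψ(x₁))² + b₀(x₁)` with `b`, `ψ`, `b₀` smooth and `b(0, 0) ≠ 0`, where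
`ψ` vanishes at `0` to order `m ∈ [2, ∞]` and `b₀` to order `n ∈ [2, ∞]`. -/
def HasNormalForm (ϕ : ℝ × ℝ → ℝ) (m n : ℕ∞) : Prop :=
  2 ≤ m ∧ 2 ≤ n ∧
  ∃ (r : ℝ) (b : ℝ × ℝ → ℝ) (ψ b₀ : ℝ → ℝ), 0 < r ∧
    ContDiffOn ℝ ∞ b (Set.Ioo (-r) r ×ˢ Set.Ioo (-r) r) ∧
    ContDiffOn ℝ ∞ ψ (Set.Ioo (-r) r) ∧
    ContDiffOn ℝ ∞ b₀ (Set.Ioo (-r) r) ∧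
    b (0, 0) ≠ 0 ∧ HasOrderAtZero ψ m ∧ HasOrderAtZero b₀ n ∧
    ∀ x ∈ Set.Ioo (-r) r ×ˢ Set.Ioo (-r) r, ϕ x = b x * (x.2 - ψ x.1) ^ 2 + b₀ x.1

/-- The exponent `(5 - 2/n)(1/p - 1/2)`, with `2/∞ = 0`. -/
def criticalOrder (n : ℕ∞) (p : ℝ) : ℝ :=
  (5 - 2 * ((n : ℝ≥0∞)⁻¹).toReal) * (1 / p - 1 / 2)

end OscConv

end

/-! The counterexample is a Knapp-type wave packet. For large `t`, take the frequency box centred at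
`t v` with half-sides `δ t^(1-1/N)`, `δ t^(1/2)`, `δ t`. A point of it is `ξ = s (y₁, y₂, 1)` with
`s ~ t`, `|y₁| ≲ δ t^(-1/N)`, `|y₂| ≲ δ t^(-1/2)`, and by homogeneity `φ(ξ) - ξ·v = s (φ(y₁, y₂, 1)
- 1)`. Since `φ` is Lipschitz near `v` and equals `1` on the graph, this is `O(t |ϕ(y)|)`. The
normal form with `2m ≥ n` gives `ϕ(y) = O(y₂² + |y₁|^N)` for every finite `N ≤ n`: the term `ψ²` is
`O(y₁^N)` exactly because `2m ≥ n`. So the phase is within `1/2` of the linear function `ξ·v` on the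
box once `δ` is small.

Let `J ~ t^(5/2-1/N)` be the Jacobian of the box and let the Fourier transform of `u` be a bump
adapted to it. Then `‖u‖_p ~ J^(1-1/p)`, while `|M_k u| ≳ t^(-k) J` on the dual box about `v`, of
volume `~ 1/J`, where the integrand does not oscillate. Boundedness would force `t^(-k) J^(2/p-1) ≤
K` for all large `t`, but the exponent of `t` on the left is `(5-2/N)(1/p-1/2) - k > 0`.

The argument is carried by `convOp_wavePacket_lower` and `IsLpLqBounded.wavePacket_bound`
(analysis), `IsLocalGraph.sub_one_isBigO` and `HasNormalForm.isBigO` (geometry), and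
`not_isLpLqBounded` (choice of box). -/

namespace OscConv

open MeasureTheory Filter Topology Asymptotics
open scoped SchwartzMap FourierTransform

/-! ### Fourier normalisation and Schwartz functions -/

/-- The normalising constant `(2π)^{-3/2}` of the Fourier transform. -/
noncomputable def fourierConst : ℝ := 1 / Real.sqrt ((2 * Real.pi) ^ 3)

theorem fourierConst_pos : 0 < fourierConst := by
  unfold fourierConst; positivity

theorem fourierConst_sq_mul : fourierConst * fourierConst * (2 * Real.pi) ^ 3 = 1 := by
  have h : (0 : ℝ) < (2 * Real.pi) ^ 3 := by positivity
  have h2 := Real.mul_self_sqrt h.le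
  unfold fourierConst
  have h3 : Real.sqrt ((2 * Real.pi) ^ 3) ≠ 0 := by positivity
  rw [div_mul_div_comm, h2, one_mul, one_div, inv_mul_cancel₀ h.ne']

theorem fourierT_def (u : E3 → ℂ) (ξ : E3) :
    fourierT u ξ = (fourierConst : ℂ) *
      ∫ x : E3, Complex.exp (Complex.I * (inner ℝ ξ x : ℝ)) * u x := by
  simp [fourierT, fourierConst]

theorem fourierTInv_def (w : E3 → ℂ) (x : E3) :
    fourierTInv w x = (fourierConst : ℂ) *
      ∫ ξ : E3, Complex.exp (-(Complex.I * (inner ℝ ξ x : ℝ))) * w ξ := by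
  simp [fourierTInv, fourierConst]

theorem fourierTInv_eq_fourier (w : E3 → ℂ) (x : E3) :
    fourierTInv w x = (fourierConst : ℂ) * 𝓕 w ((2 * Real.pi)⁻¹ • x) := by
  rw [fourierTInv_def, Real.fourier_eq']
  congr 2
  ext ξ
  rw [smul_eq_mul, inner_smul_right]
  congr 2
  have : (Real.pi : ℂ) ≠ 0 := by exact_mod_cast Real.pi_ne_zero
  push_cast
  field_simp

theorem fourierT_comp_smul (g : E3 → ℂ) (ξ : E3) :
    fourierT (fun x => g ((2 * Real.pi)⁻¹ • x)) ξ
      = ((fourierConst * (2 * Real.pi) ^ 3 : ℝ) : ℂ) * 𝓕⁻ g ξ := by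
  have hpi : (Real.pi : ℂ) ≠ 0 := by exact_mod_cast Real.pi_ne_zero
  have key := Measure.integral_comp_smul (volume : Measure E3)
    (fun y : E3 => Complex.exp ((↑(2 * Real.pi * inner ℝ y ξ) * Complex.I)) * g y)
    (2 * Real.pi)⁻¹
  rw [fourierT_def, Real.fourierInv_eq']
  simp only [smul_eq_mul]
  have h1 : (∫ x : E3, Complex.exp (Complex.I * (inner ℝ ξ x : ℝ)) * g ((2 * Real.pi)⁻¹ • x))
      = ∫ x : E3, Complex.exp ((↑(2 * Real.pi * inner ℝ ((2 * Real.pi)⁻¹ • x) ξ) * Complex.I))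
        * g ((2 * Real.pi)⁻¹ • x) := by
    congr 1
    ext x
    congr 2
    rw [inner_smul_left, real_inner_comm]
    push_cast
    simp
    field_simp
  rw [h1, key]
  have h3 : Module.finrank ℝ E3 = 3 := by simp
  have h4 : |(((2 * Real.pi)⁻¹ ^ 3)⁻¹ : ℝ)| = (2 * Real.pi) ^ 3 := by
    rw [abs_of_pos (by positivity), inv_pow, inv_inv]
  rw [h3, h4, Complex.real_smul]
  push_cast
  ring

/-- Every Schwartz function is the Fourier transform of a Schwartz function. -/
theorem exists_schwartz_fourierT_eq (w : 𝓢(E3, ℂ)) :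
    ∃ u : 𝓢(E3, ℂ), (∀ x, u x = fourierTInv w x) ∧ ∀ ξ, fourierT u ξ = w ξ := by
  have hpi : (2 * Real.pi)⁻¹ ≠ 0 := by positivity
  let e : E3 ≃L[ℝ] E3 := ContinuousLinearEquiv.smulLeft (Units.mk0 _ hpi)
  let g : 𝓢(E3, ℂ) := (fourierConst : ℂ) • 𝓕 w
  let u : 𝓢(E3, ℂ) := SchwartzMap.compCLMOfContinuousLinearEquiv ℂ e g
  have hu : ∀ x, u x = (fourierConst : ℂ) * (𝓕 w : 𝓢(E3, ℂ)) ((2 * Real.pi)⁻¹ • x) := fun x => rfl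
  refine ⟨u, fun x => ?_, fun ξ => ?_⟩
  · rw [hu, fourierTInv_eq_fourier, SchwartzMap.fourier_coe]
  · have h1 : (u : E3 → ℂ) = fun x => (fun y => (fourierConst : ℂ) * (𝓕 w : 𝓢(E3, ℂ)) y)
        ((2 * Real.pi)⁻¹ • x) := funext hu
    rw [h1, fourierT_comp_smul (fun y => (fourierConst : ℂ) * (𝓕 w : 𝓢(E3, ℂ)) y)]
    have h2 : 𝓕⁻ (fun y => (fourierConst : ℂ) * (𝓕 w : 𝓢(E3, ℂ)) y) ξ = (fourierConst : ℂ) * w ξ := by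
      have h3 : 𝓕⁻ (𝓕 w) = w := FourierTransform.fourierInv_fourier_eq w
      have h4 : 𝓕⁻ ((𝓕 w : 𝓢(E3, ℂ)) : E3 → ℂ) ξ = w ξ := by
        rw [← SchwartzMap.fourierInv_coe, h3]
      rw [← h4, Real.fourierInv_eq', Real.fourierInv_eq', ← integral_const_mul]
      congr 1
      ext y
      simp only [smul_eq_mul]
      ring
    rw [h2, ← mul_assoc]
    have h5 := fourierConst_sq_mul
    have h6 : ((fourierConst * (2 * Real.pi) ^ 3 : ℝ) : ℂ) * (fourierConst : ℂ) = 1 := by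
      rw [← Complex.ofReal_mul, ← Complex.ofReal_one]
      congr 1
      linarith
    rw [h6, one_mul]

/-! ### Linear changes of variables -/

section LinearChange

variable (L : E3 ≃L[ℝ] E3)

/-- The Jacobian of an invertible linear map of `ℝ³`. -/
noncomputable def jac : ℝ := |LinearMap.det (L : E3 →ₗ[ℝ] E3)|

theorem det_ne_zero : LinearMap.det (L : E3 →ₗ[ℝ] E3) ≠ 0 :=
  (LinearEquiv.isUnit_det' L.toLinearEquiv).ne_zero

theorem jac_pos : 0 < jac L := abs_pos.mpr (det_ne_zero L)

theorem map_volume : Measure.map L (volume : Measure E3)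
    = ENNReal.ofReal (jac L)⁻¹ • (volume : Measure E3) := by
  have := Measure.map_linearMap_addHaar_eq_smul_addHaar (volume : Measure E3) (det_ne_zero L)
  rw [abs_inv] at this
  exact this

theorem measurableEmbedding : MeasurableEmbedding L := L.toHomeomorph.measurableEmbedding

theorem integral_comp_linear (f : E3 → ℂ) :
    ∫ x, f (L x) = ((jac L)⁻¹ : ℝ) * ∫ x, f x := by
  rw [← (measurableEmbedding L).integral_map, map_volume, integral_smul_measure,
    ENNReal.toReal_ofReal (inv_nonneg.mpr (jac_pos L).le), Complex.real_smul]

theorem integral_affine (ζ : E3) (f : E3 → ℂ) :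
    ∫ ξ, f ξ = (jac L : ℂ) * ∫ η, f (ζ + L η) := by
  rw [integral_comp_linear L (fun y => f (ζ + y)), integral_add_left_eq_self, ← mul_assoc,
    ← Complex.ofReal_mul, mul_inv_cancel₀ (jac_pos L).ne', Complex.ofReal_one, one_mul]

theorem eLpNorm_comp_linear (f : E3 → ℂ) (p : ℝ≥0∞) :
    eLpNorm (fun x => f (L x)) p volume
      = ENNReal.ofReal (jac L)⁻¹ ^ (1 / p).toReal * eLpNorm f p volume := by
  have h := (measurableEmbedding L).eLpNorm_map_measure (g := f) (p := p)
    (μ := (volume : Measure E3))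
  rw [map_volume, eLpNorm_smul_measure_of_ne_zero (by simpa using jac_pos L)] at h
  exact h.symm

theorem volume_preimage_affine (ζ : E3) (s : Set E3) :
    volume ((fun x => L (x - ζ)) ⁻¹' s) = ENNReal.ofReal (jac L)⁻¹ * volume s := by
  have h1 : (fun x => L (x - ζ)) ⁻¹' s = (fun x => x + -ζ) ⁻¹' (L ⁻¹' s) := by
    ext x; simp [sub_eq_add_neg]
  rw [h1, measure_preimage_add_right]
  have h2 := Measure.addHaar_preimage_linearMap (volume : Measure E3) (det_ne_zero L) s
  rw [abs_inv] at h2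
  exact h2

end LinearChange

/-! ### Wave packets and the bound they impose -/

theorem fourierTInv_affine {L : E3 ≃L[ℝ] E3} (hL : (L : E3 →ₗ[ℝ] E3).IsSymmetric)
    (ζ : E3) (χ : E3 → ℂ) (x : E3) :
    fourierTInv (fun ξ => χ (L.symm (ξ - ζ))) x
      = (jac L : ℂ) * Complex.exp (-(Complex.I * (inner ℝ ζ x : ℝ))) * fourierTInv χ (L x) := by
  rw [fourierTInv_def, fourierTInv_def, integral_affine L ζ]
  have h : ∀ η : E3, Complex.exp (-(Complex.I * (inner ℝ (ζ + L η) x : ℝ)))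
      * χ (L.symm (ζ + L η - ζ)) = Complex.exp (-(Complex.I * (inner ℝ ζ x : ℝ))) *
        (Complex.exp (-(Complex.I * (inner ℝ η (L x) : ℝ))) * χ η) := by
    intro η
    have h1 : inner ℝ (L η) x = inner ℝ η (L x) := hL η x
    rw [add_sub_cancel_left, L.symm_apply_apply, ← mul_assoc, ← Complex.exp_add, inner_add_left, h1]
    congr 2
    push_cast
    ring
  simp_rw [h]
  rw [integral_const_mul]
  ring

/-- A phase of modulus at most `1` satisfies `cos Θ ≥ 1 - Θ²/2 ≥ 1/2`, so the real part of the
integrand is at least `μ χ / 2` and no cancellation occurs. -/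
theorem integral_oscillatory_re_lower {Θ s χ : E3 → ℝ} {μ : ℝ} (hμ : 0 ≤ μ)
    (hχ : ∀ η, 0 ≤ χ η) (hχc : Continuous χ) (hχs : ∀ η, χ η ≠ 0 → ‖η‖ ≤ 1)
    (hΘ : ∀ η, ‖η‖ ≤ 1 → |Θ η| ≤ 1) (hs : ∀ η, ‖η‖ ≤ 1 → μ ≤ s η)
    (hΘc : ContinuousOn Θ (Metric.closedBall 0 1)) (hsc : ContinuousOn s (Metric.closedBall 0 1)) :
    μ / 2 * ∫ η, χ η ≤ ‖∫ η, Complex.exp (Complex.I * (Θ η : ℝ)) * (s η : ℝ) * (χ η : ℝ)‖ := by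
  have supp : ∀ η, η ∉ Metric.closedBall (0 : E3) 1 → χ η = 0 := by
    intro η hη
    by_contra h
    exact hη (by simpa using hχs η h)
  have hχi : Integrable χ := by
    rw [← integrableOn_iff_integrable_of_support_subset (s := Metric.closedBall (0 : E3) 1)]
    · exact hχc.continuousOn.integrableOn_compact (isCompact_closedBall _ _)
    · intro η hη
      by_contra h
      exact hη (supp η h)
  have hGi : Integrable
      (fun η => Complex.exp (Complex.I * (Θ η : ℝ)) * (s η : ℝ) * (χ η : ℝ)) := by
    rw [← integrableOn_iff_integrable_of_support_subset (s := Metric.closedBall (0 : E3) 1)]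
    · apply ContinuousOn.integrableOn_compact (isCompact_closedBall _ _)
      have h1 := Complex.continuous_ofReal.comp_continuousOn hΘc
      have h2 := Complex.continuous_ofReal.comp_continuousOn hsc
      have h3 := Complex.continuous_ofReal.comp_continuousOn
        (hχc.continuousOn (s := Metric.closedBall (0 : E3) 1))
      exact ((Complex.continuous_exp.comp_continuousOn (continuousOn_const.mul h1)).mul h2).mul h3
    · intro η hη
      by_contra h
      exact hη (by simp [supp η h])
  refine le_trans ?_ (Complex.re_le_norm _)
  have hre : (∫ η, Complex.exp (Complex.I * (Θ η : ℝ)) * (s η : ℝ) * (χ η : ℝ)).re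
      = ∫ η, (Complex.exp (Complex.I * (Θ η : ℝ)) * (s η : ℝ) * (χ η : ℝ)).re :=
    (integral_re hGi).symm
  rw [hre, ← integral_const_mul]
  refine integral_mono (hχi.const_mul _) hGi.re ?_
  intro η
  have hval : (Complex.exp (Complex.I * (Θ η : ℝ)) * (s η : ℝ) * (χ η : ℝ)).re
      = Real.cos (Θ η) * s η * χ η := by
    rw [mul_comm Complex.I, Complex.re_mul_ofReal, Complex.re_mul_ofReal,
      Complex.exp_ofReal_mul_I_re]
  change μ / 2 * χ η ≤ (Complex.exp (Complex.I * (Θ η : ℝ)) * (s η : ℝ) * (χ η : ℝ)).re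
  rw [hval]
  by_cases hη : χ η = 0
  · simp [hη]
  have hn := hχs η hη
  refine mul_le_mul_of_nonneg_right ?_ (hχ η)
  have h1 : 1 / 2 ≤ Real.cos (Θ η) := by
    have h2 := Real.one_sub_sq_div_two_le_cos (x := Θ η)
    have h3 : Θ η ^ 2 ≤ 1 := by
      rw [sq_le_one_iff_abs_le_one]; exact hΘ η hn
    linarith
  have h4 := hs η hn
  nlinarith

/-- On the translated dual box, the image of a wave packet on which the phase is nearly linear
is bounded from below. -/
theorem convOp_wavePacket_lower {φ : E3 → ℝ} {a : E3 → ℂ} {v ζ : E3} {L : E3 ≃L[ℝ] E3}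
    (hL : (L : E3 →ₗ[ℝ] E3).IsSymmetric) {χ : E3 → ℝ} {μ : ℝ} (hμ : 0 ≤ μ)
    (hχ : ∀ η, 0 ≤ χ η) (hχc : Continuous χ) (hχs : ∀ η, χ η ≠ 0 → ‖η‖ ≤ 1)
    (hφc : ContinuousOn φ {0}ᶜ) (hac : Continuous a)
    (h0 : ∀ η, ‖η‖ ≤ 1 → ζ + L η ≠ 0)
    (hφ : ∀ η, ‖η‖ ≤ 1 → |φ (ζ + L η) - inner ℝ (ζ + L η) v| ≤ 1 / 2)
    (ha : ∀ η, ‖η‖ ≤ 1 → ∃ s : ℝ, a (ζ + L η) = s ∧ μ ≤ s)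
    {u : E3 → ℂ} (hu : ∀ ξ, fourierT u ξ = (χ (L.symm (ξ - ζ)) : ℝ))
    {x : E3} (hx : ‖L (x - v)‖ ≤ 1 / 2) :
    fourierConst * (jac L * (μ / 2 * ∫ η, χ η)) ≤ ‖convOp φ a u x‖ := by
  have hJ := jac_pos L
  have hmap : ContinuousOn (fun η : E3 => ζ + L η) (Metric.closedBall 0 1) := by fun_prop
  -- With `ξ = ζ + L η`, the full phase `φ(ξ) - ξ·x` equals `Θ η - ζ·(x - v)`; the last term is
  -- constant in `η` and contributes only a unimodular factor.
  set Θ : E3 → ℝ := fun η => φ (ζ + L η) - inner ℝ (ζ + L η) v - inner ℝ η (L (x - v)) with hΘdef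
  set s : E3 → ℝ := fun η => (a (ζ + L η)).re with hsdef
  have key := integral_oscillatory_re_lower (Θ := Θ) (s := s) hμ hχ hχc hχs
    (by
      intro η hη
      have h1 := abs_real_inner_le_norm η (L (x - v))
      have h2 : ‖η‖ * ‖L (x - v)‖ ≤ 1 * (1 / 2) := by gcongr
      calc |Θ η| ≤ |φ (ζ + L η) - inner ℝ (ζ + L η) v| + |inner ℝ η (L (x - v))| := abs_sub _ _
        _ ≤ 1 := by linarith [hφ η hη])
    (by
      intro η hη
      obtain ⟨t, ht, hμt⟩ := ha η hη
      simpa [hsdef, ht] using hμt)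
    (by
      refine ContinuousOn.sub (ContinuousOn.sub ?_ (by fun_prop)) (by fun_prop)
      refine hφc.comp hmap ?_
      intro η hη
      exact h0 η (by simpa using hη))
    (by fun_prop)
  rw [convOp, fourierTInv_def, norm_mul, Complex.norm_real, Real.norm_of_nonneg fourierConst_pos.le,
    integral_affine L ζ, norm_mul, Complex.norm_real, Real.norm_of_nonneg hJ.le]
  refine mul_le_mul_of_nonneg_left (mul_le_mul_of_nonneg_left ?_ hJ.le) fourierConst_pos.le
  refine key.trans (le_of_eq ?_)
  have hpt : ∀ η, Complex.exp (-(Complex.I * (inner ℝ (ζ + L η) x : ℝ))) *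
      (Complex.exp (Complex.I * (φ (ζ + L η) : ℝ)) * a (ζ + L η) * fourierT u (ζ + L η))
      = Complex.exp (((-inner ℝ ζ (x - v) : ℝ) : ℂ) * Complex.I) *
        (Complex.exp (Complex.I * (Θ η : ℝ)) * (s η : ℝ) * (χ η : ℝ)) := by
    intro η
    rw [hu, add_sub_cancel_left, L.symm_apply_apply]
    by_cases hη : χ η = 0
    · simp [hη]
    obtain ⟨t, ht, -⟩ := ha η (hχs η hη)
    have hsη : a (ζ + L η) = (s η : ℝ) := by simp [hsdef, ht]
    rw [hsη, ← mul_assoc, ← mul_assoc, ← mul_assoc, ← mul_assoc, ← Complex.exp_add,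
      ← Complex.exp_add]
    congr 3
    have h1 : inner ℝ (L η) (x - v) = inner ℝ η (L (x - v)) := hL η (x - v)
    have h2 : inner ℝ (ζ + L η) x
        = inner ℝ (ζ + L η) v + inner ℝ ζ (x - v) + inner ℝ η (L (x - v)) := by
      rw [← h1, inner_sub_right, inner_sub_right, inner_add_left, inner_add_left]
      ring
    rw [h2, hΘdef]
    push_cast
    ring
  simp_rw [hpt]
  rw [integral_const_mul, norm_mul, Complex.norm_exp_ofReal_mul_I, one_mul]

/-- A smooth nonnegative function supported in the unit ball. -/
theorem exists_bump_unitBall : ∃ χ : E3 → ℝ, ContDiff ℝ ∞ χ ∧ HasCompactSupport χ ∧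
    (∀ η, 0 ≤ χ η) ∧ (∀ η, χ η ≠ 0 → ‖η‖ ≤ 1) ∧ 0 < ∫ η, χ η := by
  let bump : ContDiffBump (0 : E3) := ⟨1 / 2, 1, by norm_num, by norm_num⟩
  refine ⟨bump, bump.contDiff, bump.hasCompactSupport, fun η => bump.nonneg, fun η hη => ?_,
    bump.integral_pos⟩
  have h : η ∈ Function.support bump := hη
  rw [bump.support_eq] at h
  simpa using Metric.ball_subset_closedBall h

/-- A Schwartz function whose Fourier transform is an affine image of a given bump function. -/
theorem exists_wavePacket {χ : E3 → ℝ} (hχd : ContDiff ℝ ∞ χ) (hχk : HasCompactSupport χ)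
    {L : E3 ≃L[ℝ] E3} (hL : (L : E3 →ₗ[ℝ] E3).IsSymmetric) (ζ : E3) :
    ∃ u : 𝓢(E3, ℂ), (∀ ξ, fourierT u ξ = (χ (L.symm (ξ - ζ)) : ℝ)) ∧
      ∀ p, eLpNorm u p volume = ENNReal.ofReal (jac L) * (ENNReal.ofReal (jac L)⁻¹ ^ (1 / p).toReal
        * eLpNorm (fourierTInv fun η => (χ η : ℂ)) p volume) := by
  have hwd : ContDiff ℝ ∞ (fun ξ => ((χ (L.symm (ξ - ζ)) : ℝ) : ℂ)) :=
    Complex.ofRealCLM.contDiff.comp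
      (hχd.comp (L.symm.contDiff.comp (contDiff_id.sub contDiff_const)))
  have hwk : HasCompactSupport (fun ξ => ((χ (L.symm (ξ - ζ)) : ℝ) : ℂ)) :=
    (hχk.comp_left (g := fun t : ℝ => (t : ℂ)) Complex.ofReal_zero).comp_homeomorph
      ((Homeomorph.subRight ζ).trans L.symm.toHomeomorph)
  obtain ⟨u, hu, huF⟩ := exists_schwartz_fourierT_eq (hwk.toSchwartzMap hwd)
  refine ⟨u, huF, fun p => ?_⟩
  have hnorm : ∀ x, ‖u x‖ = ‖((jac L : ℂ) • fun x => fourierTInv (fun η => (χ η : ℂ)) (L x)) x‖ := by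
    intro x
    have h1 := fourierTInv_affine hL ζ (fun η => ((χ η : ℝ) : ℂ)) x
    have h2 : ((hwk.toSchwartzMap hwd : 𝓢(E3, ℂ)) : E3 → ℂ)
        = fun ξ => ((χ (L.symm (ξ - ζ)) : ℝ) : ℂ) := rfl
    have h4 : ‖Complex.exp (-(Complex.I * (inner ℝ ζ x : ℝ)))‖ = 1 := by
      rw [show -(Complex.I * ((inner ℝ ζ x : ℝ) : ℂ)) = ((-inner ℝ ζ x : ℝ) : ℂ) * Complex.I by
        push_cast; ring, Complex.norm_exp_ofReal_mul_I]
    rw [hu x, h2, h1, norm_mul, norm_mul, h4, mul_one, Pi.smul_apply, norm_smul]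
  rw [eLpNorm_congr_norm_ae (Eventually.of_forall hnorm), eLpNorm_const_smul, eLpNorm_comp_linear]
  congr 1
  rw [← ofReal_norm, Complex.norm_real, Real.norm_of_nonneg (jac_pos L).le]

theorem eLpNorm_lower_of_le_on {f : E3 → ℂ} {S : Set E3} (hS : MeasurableSet S) (hS0 : volume S ≠ 0)
    {q : ℝ≥0∞} (hq : q ≠ 0) {m : ℝ} (hm : 0 ≤ m) (hf : ∀ x ∈ S, m ≤ ‖f x‖) :
    ENNReal.ofReal m * volume S ^ (1 / q).toReal ≤ eLpNorm f q volume := by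
  have h1 : eLpNorm (S.indicator fun _ => m) q volume
      = ENNReal.ofReal m * volume S ^ (1 / q).toReal := by
    rw [eLpNorm_indicator_const' hS hS0 hq, ← ofReal_norm, Real.norm_of_nonneg hm]
    simp
  rw [← h1]
  refine eLpNorm_mono fun x => ?_
  by_cases hx : x ∈ S
  · rw [Set.indicator_of_mem hx, Real.norm_of_nonneg hm]
    exact hf x hx
  · rw [Set.indicator_of_notMem hx]
    simp

/-- The bound that `L^p → L^q` boundedness imposes on a wave packet. -/
theorem IsLpLqBounded.wavePacket_bound {φ : E3 → ℝ} {a : E3 → ℂ} (v : E3)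
    (hφc : ContinuousOn φ {0}ᶜ) (hac : Continuous a)
    {p q : ℝ≥0∞} (hq : q ≠ 0) (hb : IsLpLqBounded φ a p q) :
    ∃ K : ℝ, ∀ (L : E3 ≃L[ℝ] E3) (ζ : E3) (μ : ℝ), (L : E3 →ₗ[ℝ] E3).IsSymmetric → 0 ≤ μ →
      (∀ η, ‖η‖ ≤ 1 → ζ + L η ≠ 0) →
      (∀ η, ‖η‖ ≤ 1 → |φ (ζ + L η) - inner ℝ (ζ + L η) v| ≤ 1 / 2) →
      (∀ η, ‖η‖ ≤ 1 → ∃ s : ℝ, a (ζ + L η) = s ∧ μ ≤ s) →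
      μ * (jac L)⁻¹ ^ (1 / q).toReal ≤ K * (jac L)⁻¹ ^ (1 / p).toReal := by
  obtain ⟨C, hC⟩ := hb
  obtain ⟨χ, hχd, hχk, hχ0, hχs, hχI⟩ := exists_bump_unitBall
  set X : ℝ := ∫ η, χ η
  have hcF := fourierConst_pos
  -- The packet with `L = id`, `ζ = 0` is Schwartz, which shows that the reference `L^p` norm is
  -- finite.
  obtain ⟨W, -, hWp⟩ := exists_wavePacket hχd hχk (L := ContinuousLinearEquiv.refl ℝ E3)
    (fun x y => rfl) 0
  have hUfin : eLpNorm (fourierTInv fun η => (χ η : ℂ)) p volume ≠ ⊤ := by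
    have h1 := (W.memLp p).eLpNorm_ne_top
    rw [hWp] at h1
    intro h2
    have hJ := jac_pos (ContinuousLinearEquiv.refl ℝ E3)
    rw [h2, ENNReal.mul_top, ENNReal.mul_top] at h1
    · exact h1 rfl
    · simpa using hJ
    · exact (ENNReal.rpow_pos (by simpa using hJ) ENNReal.ofReal_ne_top).ne'
  generalize hUn : eLpNorm (fourierTInv fun η => (χ η : ℂ)) p volume = Un at hUfin
  set V : ℝ≥0∞ := volume (Metric.closedBall (0 : E3) (1 / 2)) with hVdef
  have hV0 : V ≠ 0 := (Metric.measure_closedBall_pos volume _ (by norm_num)).ne'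
  have hVt : V ≠ ⊤ := (isCompact_closedBall _ _).measure_lt_top.ne
  clear_value V
  have hVp : 0 < V.toReal := ENNReal.toReal_pos hV0 hVt
  have hr0 : 0 ≤ (1 / q).toReal := ENNReal.toReal_nonneg
  have hr1 : 0 ≤ (1 / p).toReal := ENNReal.toReal_nonneg
  have hc₀p : 0 < fourierConst * (1 / 2 * X) * V.toReal ^ (1 / q).toReal := by
    positivity
  -- The constant must not depend on `L`, `ζ`, `μ`. The factor `jac L` occurs on both sides of the
  -- inequality and cancels at the end.
  refine ⟨C * Un.toReal / (fourierConst * (1 / 2 * X) * V.toReal ^ (1 / q).toReal), ?_⟩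
  intro L ζ μ hL hμ h0 hφ ha
  have hJ := jac_pos L
  obtain ⟨u, huF, hun⟩ := exists_wavePacket hχd hχk hL ζ
  have hSv : volume ((fun x => L (x - v)) ⁻¹' Metric.closedBall 0 (1 / 2))
      = ENNReal.ofReal (jac L)⁻¹ * V := by rw [volume_preimage_affine L v _, hVdef]
  have hm0 : 0 ≤ fourierConst * (jac L * (μ / 2 * X)) := by positivity
  have hfin := (eLpNorm_lower_of_le_on (f := convOp φ a u) (q := q)
    (Metric.isClosed_closedBall.preimage
      (show Continuous fun x => L (x - v) by fun_prop)).measurableSet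
    (by rw [hSv]; exact mul_ne_zero (by simpa using hJ) hV0) hq hm0
    (fun x hx => convOp_wavePacket_lower hL hμ hχ0 hχd.continuous hχs hφc hac h0 hφ ha huF
      (by simpa using hx))).trans (hC u)
  rw [hun, hSv, hUn] at hfin
  have hreal := ENNReal.toReal_mono (by
    have h5 : ENNReal.ofReal (jac L)⁻¹ ^ (1 / p).toReal ≠ ⊤ :=
      ENNReal.rpow_ne_top_of_nonneg hr1 ENNReal.ofReal_ne_top
    exact ENNReal.mul_ne_top ENNReal.coe_ne_top (ENNReal.mul_ne_top ENNReal.ofReal_ne_top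
      (ENNReal.mul_ne_top h5 hUfin))) hfin
  have hJi : 0 ≤ (jac L)⁻¹ := inv_nonneg.mpr hJ.le
  simp only [ENNReal.toReal_mul, ← ENNReal.toReal_rpow, ENNReal.toReal_ofReal hm0,
    ENNReal.toReal_ofReal hJi, ENNReal.toReal_ofReal hJ.le, ENNReal.coe_toReal] at hreal
  rw [Real.mul_rpow hJi hVp.le] at hreal
  rw [div_mul_eq_mul_div, le_div_iff₀ hc₀p]
  refine le_of_mul_le_mul_left ?_ hJ
  calc _ = fourierConst * (jac L * (μ / 2 * X))
        * ((jac L)⁻¹ ^ (1 / q).toReal * V.toReal ^ (1 / q).toReal) := by ring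
    _ ≤ _ := hreal
    _ = _ := by ring

/-! ### Size of the phase near the pole -/

theorem isBigO_pow_of_le {M N : ℕ} (h : N ≤ M) :
    (fun x : ℝ => x ^ M) =O[𝓝 0] fun x => x ^ N := by
  refine IsBigO.of_bound 1 ?_
  filter_upwards [Metric.ball_mem_nhds (0 : ℝ) one_pos] with x hx
  have hx1 : |x| ≤ 1 := by simpa using (mem_ball_zero_iff.mp hx).le
  rw [one_mul, norm_pow, norm_pow]
  exact pow_le_pow_of_le_one (norm_nonneg _) hx1 h

/-- For finite order the cofactor `β` is bounded near `0`; for infinite order the Taylor polynomial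
of degree `N` vanishes and only the remainder is left. -/
theorem HasOrderAtZero.isBigO_pow {h : ℝ → ℝ} {M : ℕ∞} (hM : HasOrderAtZero h M) {r : ℝ}
    (hr : 0 < r) (hd : ContDiffOn ℝ ∞ h (Set.Ioo (-r) r)) {N : ℕ} (hN : (N : ℕ∞) ≤ M) :
    h =O[𝓝 0] fun x => x ^ N := by
  have mem : ∀ {r : ℝ}, 0 < r → Set.Ioo (-r) r ∈ 𝓝 (0 : ℝ) := fun hr =>
    Ioo_mem_nhds (neg_neg_of_pos hr) hr
  induction M using ENat.recTopCoe with
  | top =>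
    have h0 : (0 : ℝ) ∈ Set.Ioo (-r) r := ⟨neg_neg_of_pos hr, hr⟩
    have ht := taylor_isLittleO (convex_Ioo (-r) r) h0 (hd.of_le (n := ∞) (m := N)
      (by exact_mod_cast le_top))
    have hz : ∀ x, taylorWithinEval h N (Set.Ioo (-r) r) 0 x = 0 := by
      intro x
      rw [taylor_within_apply]
      refine Finset.sum_eq_zero fun i _ => ?_
      rw [iteratedDerivWithin_of_isOpen isOpen_Ioo h0, hM.2 rfl i, smul_zero]
    simp only [hz, sub_zero] at ht
    rw [isOpen_Ioo.nhdsWithin_eq h0] at ht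
    exact ht.isBigO
  | coe M =>
    obtain ⟨s, hs, β, hβ, -, hf⟩ := hM.1 M rfl
    have hc : ContinuousAt β 0 := hβ.continuousOn.continuousAt (mem hs)
    have h1 : h =ᶠ[𝓝 0] fun x => x ^ M * β x := by
      filter_upwards [mem hs] with x hx using hf x hx
    have h2 : (fun x : ℝ => x ^ M * β x) =O[𝓝 0] fun x => x ^ N * (1 : ℝ) :=
      (isBigO_pow_of_le (by exact_mod_cast hN)).mul (hc.isBigO_one ℝ)
    simpa using h1.trans_isBigO h2

/-- The anisotropic size of a phase in normal form. -/
theorem HasNormalForm.isBigO {ϕ : ℝ × ℝ → ℝ} {m n : ℕ∞} (h : HasNormalForm ϕ m n)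
    (hmn : n ≤ 2 * m) {N : ℕ} (hN : (N : ℕ∞) ≤ n) :
    ϕ =O[𝓝 0] fun y : ℝ × ℝ => y.2 ^ 2 + |y.1| ^ N := by
  obtain ⟨-, -, r, b, ψ, b₀, hr, hb, hψ, hb₀, -, hψm, hb₀n, heq⟩ := h
  have hU : Set.Ioo (-r) r ×ˢ Set.Ioo (-r) r ∈ 𝓝 (0 : ℝ × ℝ) :=
    prod_mem_nhds (Ioo_mem_nhds (neg_neg_of_pos hr) hr) (Ioo_mem_nhds (neg_neg_of_pos hr) hr)
  have hbO : b =O[𝓝 0] fun _ => (1 : ℝ) := (hb.continuousOn.continuousAt hU).isBigO_one ℝ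
  have hfst : Tendsto (Prod.fst : ℝ × ℝ → ℝ) (𝓝 0) (𝓝 0) := continuous_fst.tendsto 0
  have hψO : (fun x => ψ x ^ 2) =O[𝓝 0] fun x => x ^ N := by
    -- This is where `n ≤ 2 * m` enters: `ψ = O(x^M)` gives `ψ² = O(x^(2M))`, and `2M ≥ N` is
    -- needed.
    obtain ⟨M, hM, hNM⟩ : ∃ M : ℕ, (M : ℕ∞) ≤ m ∧ N ≤ M * 2 := by
      induction m using ENat.recTopCoe with
      | top => exact ⟨N, le_top, by omega⟩
      | coe m =>
        refine ⟨m, le_rfl, ?_⟩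
        have := hN.trans hmn
        rw [mul_comm]
        exact_mod_cast this
    have h1 := (hψm.isBigO_pow hr hψ hM).pow 2
    simp only [← pow_mul] at h1
    exact h1.trans (isBigO_pow_of_le hNM)
  have habs : ∀ f : ℝ → ℝ, f =O[𝓝 0] (fun x => x ^ N) →
      (fun y : ℝ × ℝ => f y.1) =O[𝓝 0] fun y : ℝ × ℝ => y.2 ^ 2 + |y.1| ^ N := by
    intro f hf
    refine (hf.comp_tendsto hfst).trans (IsBigO.of_bound 1 (Eventually.of_forall fun y => ?_))
    have : 0 ≤ y.2 ^ 2 := sq_nonneg _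
    have h2 : 0 ≤ |y.1| ^ N := by positivity
    simp only [Function.comp_apply, norm_pow, Real.norm_eq_abs, one_mul]
    rw [abs_of_nonneg (add_nonneg this h2)]
    linarith
  have hsq : (fun y : ℝ × ℝ => (y.2 - ψ y.1) ^ 2) =O[𝓝 0]
      fun y : ℝ × ℝ => y.2 ^ 2 + |y.1| ^ N := by
    have h1 : (fun y : ℝ × ℝ => y.2 ^ 2) =O[𝓝 0] fun y : ℝ × ℝ => y.2 ^ 2 + |y.1| ^ N := by
      refine IsBigO.of_bound 1 (Eventually.of_forall fun y => ?_)
      have h0 : 0 ≤ y.2 ^ 2 := sq_nonneg _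
      have h2 : 0 ≤ |y.1| ^ N := by positivity
      rw [Real.norm_of_nonneg h0, Real.norm_of_nonneg (add_nonneg h0 h2)]
      linarith
    refine IsBigO.trans (IsBigO.of_bound 2 (Eventually.of_forall fun y => ?_))
      (h1.add (habs _ hψO))
    rw [Real.norm_of_nonneg (sq_nonneg _),
      Real.norm_of_nonneg (add_nonneg (sq_nonneg _) (sq_nonneg _))]
    nlinarith [sq_nonneg (y.2 + ψ y.1)]
  have hev : ϕ =ᶠ[𝓝 0] fun y => b y * (y.2 - ψ y.1) ^ 2 + b₀ y.1 := by
    filter_upwards [hU] with y hy using heq y hy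
  refine hev.trans_isBigO (IsBigO.add ?_ (habs _ (hb₀n.isBigO_pow hr hb₀ hN)))
  simpa using hbO.mul hsq

theorem continuous_graphPoint (f : ℝ × ℝ → ℝ) {y : ℝ × ℝ} (hf : ContinuousAt f y) :
    ContinuousAt (fun y : ℝ × ℝ => (!₂[y.1, y.2, f y] : E3)) y := by
  have h : ContinuousAt (fun y : ℝ × ℝ => (![y.1, y.2, f y] : Fin 3 → ℝ)) y := by
    rw [continuousAt_pi]
    intro i
    fin_cases i
    · exact continuousAt_fst
    · exact continuousAt_snd
    · exact hf
  exact (PiLp.continuous_toLp 2 _).continuousAt.comp h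

theorem northPole_ne_zero : northPole ≠ 0 := by
  intro h
  have := congrArg (fun x : E3 => x 2) h
  simp [northPole] at this

/-- On the tangent plane, the phase differs from its linear part by at most the height of the
graph. -/
theorem IsLocalGraph.sub_one_isBigO {φ : E3 → ℝ} {ϕ : ℝ × ℝ → ℝ} (h : IsLocalGraph φ ϕ)
    (hφ : IsPhase φ) :
    (fun y : ℝ × ℝ => φ !₂[y.1, y.2, 1] - 1) =O[𝓝 0] ϕ := by
  obtain ⟨h0, r, hr, hd, heq⟩ := h
  have hU : Set.Ioo (-r) r ×ˢ Set.Ioo (-r) r ∈ 𝓝 (0 : ℝ × ℝ) :=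
    prod_mem_nhds (Ioo_mem_nhds (neg_neg_of_pos hr) hr) (Ioo_mem_nhds (neg_neg_of_pos hr) hr)
  have hcd : ContDiffAt ℝ 1 φ northPole :=
    (hφ.smooth.contDiffAt (isOpen_compl_singleton.mem_nhds northPole_ne_zero)).of_le
      (by exact_mod_cast le_top)
  -- The points `(y, 1)` and `(y, 1 + ϕ y)` lie at distance `|ϕ y|`, and `φ = 1` at the second, so
  -- the local Lipschitz constant is the `O` constant.
  obtain ⟨K, t, ht, hK⟩ := hcd.exists_lipschitzOnWith
  have hc : ContinuousAt ϕ 0 := hd.continuousOn.continuousAt hU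
  have h00 : ϕ 0 = 0 := h0
  have e1 : ∀ᶠ y : ℝ × ℝ in 𝓝 0, (!₂[y.1, y.2, 1] : E3) ∈ t := by
    have := continuous_graphPoint (fun _ => 1) (y := 0) continuousAt_const
    exact this (by simpa [northPole] using ht)
  have e2 : ∀ᶠ y : ℝ × ℝ in 𝓝 0, (!₂[y.1, y.2, 1 + ϕ y] : E3) ∈ t := by
    have := continuous_graphPoint (fun y => 1 + ϕ y) (y := 0) (continuousAt_const.add hc)
    exact this (by simpa [northPole, h00] using ht)
  refine IsBigO.of_bound K ?_
  filter_upwards [e1, e2, hU] with y h1 h2 hy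
  have h3 := hK.dist_le_mul _ h1 _ h2
  rw [heq y hy, Real.dist_eq] at h3
  refine h3.trans (le_of_eq ?_)
  congr 1
  rw [EuclideanSpace.dist_eq]
  simp [Fin.sum_univ_three, Real.dist_eq, Real.sqrt_sq_eq_abs]

/-- As the inequality for `k` is strict and `2/N → 0`, infinite order can be replaced by a large
finite `N`. -/
theorem exists_nat_lt_order {n : ℕ∞} (hn : 2 ≤ n) {k p : ℝ} (hk : k < criticalOrder n p) :
    ∃ N : ℕ, 2 ≤ N ∧ (N : ℕ∞) ≤ n ∧ k < (5 - 2 * (N : ℝ)⁻¹) * (1 / p - 1 / 2) := by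
  induction n using ENat.recTopCoe with
  | top =>
    have ht : Tendsto (fun N : ℕ => (5 - 2 * (N : ℝ)⁻¹) * (1 / p - 1 / 2)) atTop
        (𝓝 ((5 - 2 * 0) * (1 / p - 1 / 2))) :=
      (tendsto_const_nhds.sub (tendsto_const_nhds.mul tendsto_inv_atTop_nhds_zero_nat)).mul_const _
    have hk' : k < (5 - 2 * 0) * (1 / p - 1 / 2) := by simpa [criticalOrder] using hk
    obtain ⟨N, h1, h2⟩ := ((ht.eventually_const_lt hk').and (eventually_ge_atTop 2)).exists
    exact ⟨N, h2, le_top, h1⟩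
  | coe N =>
    exact ⟨N, by exact_mod_cast hn, le_rfl, by simpa [criticalOrder] using hk⟩

/-! ### Amplitudes and frequency boxes -/

/-- An amplitude of order `-k` with a prescribed angular profile. -/
theorem exists_amplitude (k : ℝ) {θ : E3 → ℝ} (hθ : ContDiff ℝ ∞ θ) :
    ∃ a : E3 → ℂ, IsAmplitude k a ∧
      (∀ ξ, 1 ≤ ‖ξ‖ → a ξ = ((‖ξ‖ ^ (-k) * θ (‖ξ‖⁻¹ • ξ) : ℝ) : ℂ)) ∧
      ∀ ξ, a ξ ≠ 0 → 1 / 2 ≤ ‖ξ‖ ∧ θ (‖ξ‖⁻¹ • ξ) ≠ 0 := by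
  let bump : ContDiffBump (0 : E3) := ⟨1 / 2, 1, by norm_num, by norm_num⟩
  have hlarge : ∀ ξ, 1 ≤ ‖ξ‖ → bump ξ = 0 := fun ξ h =>
    bump.zero_of_le_dist (by simpa using h)
  have hsmall : ∀ ξ, ‖ξ‖ ≤ 1 / 2 → bump ξ = 1 := fun ξ h =>
    bump.one_of_mem_closedBall (mem_closedBall_zero_iff.mpr h)
  -- The factor `1 - bump` vanishes near the origin, where the homogeneous expression is singular,
  -- and equals `1` for `‖ξ‖ ≥ 1`.
  let g : E3 → ℝ := fun ξ => (1 - bump ξ) * (‖ξ‖ ^ (-k) * θ (‖ξ‖⁻¹ • ξ))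
  have hg : ContDiff ℝ ∞ g := by
    rw [contDiff_iff_contDiffAt]
    intro ξ
    by_cases h0 : ξ = 0
    · subst h0
      have hev : g =ᶠ[𝓝 0] fun _ => 0 := by
        filter_upwards [Metric.closedBall_mem_nhds (0 : E3) (by norm_num : (0 : ℝ) < 1 / 2)]
          with ξ hξ
        simp [g, hsmall ξ (by simpa using hξ)]
      exact contDiffAt_const.congr_of_eventuallyEq hev
    · have hn : ContDiffAt ℝ ∞ (fun ξ : E3 => ‖ξ‖) ξ := contDiffAt_norm ℝ h0
      have hn0 : ‖ξ‖ ≠ 0 := norm_ne_zero_iff.mpr h0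
      exact (contDiffAt_const.sub bump.contDiff.contDiffAt).mul
        ((hn.rpow_const_of_ne hn0).mul
          (hθ.contDiffAt.comp ξ ((hn.inv hn0).smul contDiffAt_id)))
  have hval : ∀ ξ, 1 ≤ ‖ξ‖ → g ξ = ‖ξ‖ ^ (-k) * θ (‖ξ‖⁻¹ • ξ) := by
    intro ξ h
    simp [g, hlarge ξ h]
  refine ⟨fun ξ => (g ξ : ℂ), ⟨Complex.ofRealCLM.contDiff.comp hg, 1, one_pos, ?_⟩, ?_, ?_⟩
  · intro ξ hξ t ht
    have ht0 : 0 < t := by linarith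
    have hnorm : ‖t • ξ‖ = t * ‖ξ‖ := by rw [norm_smul, Real.norm_of_nonneg ht0.le]
    have h1 : 1 ≤ ‖t • ξ‖ := by rw [hnorm]; nlinarith
    have hdir : (t * ‖ξ‖)⁻¹ • t • ξ = ‖ξ‖⁻¹ • ξ := by
      rw [smul_smul]
      congr 1
      field_simp
    rw [hval _ h1, hval _ hξ, hnorm, hdir, Real.mul_rpow ht0.le (norm_nonneg _)]
    push_cast
    ring
  · intro ξ h
    exact congrArg Complex.ofReal (hval ξ h)
  · intro ξ h
    have h' : g ξ ≠ 0 := Complex.ofReal_ne_zero.mp h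
    constructor
    · by_contra hlt
      exact h' (by simp [g, hsmall ξ (not_le.mp hlt).le])
    · intro hz
      exact h' (by simp [g, hz])

/-- A diagonal dilation of `ℝ³`. -/
theorem exists_diagonal {A : Fin 3 → ℝ} (hA : ∀ i, 0 < A i) :
    ∃ L : E3 ≃L[ℝ] E3, (L : E3 →ₗ[ℝ] E3).IsSymmetric ∧ (∀ x i, L x i = A i * x i) ∧
      jac L = A 0 * A 1 * A 2 := by
  let T : E3 →ₗ[ℝ] E3 := Matrix.toLpLin 2 2 (Matrix.diagonal A)
  have hT : ∀ x i, T x i = A i * x i := by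
    intro x i
    simp [T, Matrix.toLpLin_apply, Matrix.mulVec_diagonal]
  have hdet : LinearMap.det T = A 0 * A 1 * A 2 := by
    simp only [T, Matrix.toLpLin_eq_toLin, LinearMap.det_toLin, Matrix.det_diagonal,
      Fin.prod_univ_three]
  have hpos : 0 < A 0 * A 1 * A 2 := mul_pos (mul_pos (hA 0) (hA 1)) (hA 2)
  let L := (LinearEquiv.ofIsUnitDet (v := (EuclideanSpace.basisFun (Fin 3) ℝ).toBasis)
    (v' := (EuclideanSpace.basisFun (Fin 3) ℝ).toBasis) (f := T) (by
      rw [LinearMap.det_toMatrix, hdet]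
      exact hpos.ne'.isUnit)).toContinuousLinearEquiv
  have hL : (L : E3 →ₗ[ℝ] E3) = T := rfl
  refine ⟨L, ?_, hT, ?_⟩
  · rw [hL]
    intro x y
    simp only [PiLp.inner_apply, hT]
    refine Finset.sum_congr rfl fun i _ => ?_
    simp
    ring
  · rw [jac, hL, hdet, abs_of_pos hpos]

/-- The frequency box of the counterexample lies in a thin conic neighbourhood of the pole. -/
theorem box_subset_cone {A : Fin 3 → ℝ} {L : E3 ≃L[ℝ] E3} (hL : ∀ x i, L x i = A i * x i)
    (hA : ∀ i, 0 < A i) {t : ℝ} (h2 : A 2 ≤ t / 2) {η : E3} (hη : ‖η‖ ≤ 1) :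
    ∃ (s : ℝ) (y : ℝ × ℝ), t • northPole + L η = s • (!₂[y.1, y.2, 1] : E3) ∧
      t / 2 ≤ s ∧ s ≤ 2 * t ∧ |y.1| ≤ 2 * A 0 / t ∧ |y.2| ≤ 2 * A 1 / t := by
  have hA2 := hA 2
  have hco : ∀ i, |A i * η i| ≤ A i := by
    intro i
    have h1 : |η i| ≤ 1 := (PiLp.norm_apply_le η i).trans hη
    rw [abs_mul, abs_of_pos (hA i)]
    exact mul_le_of_le_one_right (hA i).le h1
  have h3 := abs_le.mp (hco 2)
  have hs : t / 2 ≤ t + A 2 * η 2 := by linarith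
  have hs0 : 0 < t + A 2 * η 2 := by linarith
  have ht : 0 < t := by linarith
  have hq : ∀ i, |A i * η i / (t + A 2 * η 2)| ≤ 2 * A i / t := by
    intro i
    rw [abs_div, abs_of_pos hs0, div_le_div_iff₀ hs0 ht]
    have := hco i
    have := hA i
    nlinarith
  refine ⟨t + A 2 * η 2, (A 0 * η 0 / (t + A 2 * η 2), A 1 * η 1 / (t + A 2 * η 2)), ?_, hs,
    by linarith, hq 0, hq 1⟩
  ext i
  fin_cases i <;> simp [hL, northPole] <;> field_simp

/-- The sign of `k` decides which of the two bounds on `s` is used; `4 ^ (-|k|)` covers both cases.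
-/
theorem rpow_neg_lower {s t k : ℝ} (ht : 0 < t) (h1 : t / 4 ≤ s) (h2 : s ≤ 4 * t) :
    4 ^ (-|k|) * t ^ (-k) ≤ s ^ (-k) := by
  have hs : 0 < s := by linarith
  rcases le_total 0 k with hk | hk
  · rw [abs_of_nonneg hk, ← Real.mul_rpow (by norm_num) ht.le]
    exact Real.rpow_le_rpow_of_nonpos hs h2 (by linarith)
  · rw [abs_of_nonpos hk, neg_neg]
    have h3 : (4 : ℝ) ^ k = (1 / 4) ^ (-k) := by
      rw [one_div, Real.inv_rpow (by norm_num), Real.rpow_neg (by norm_num), inv_inv]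
    rw [h3, ← Real.mul_rpow (by norm_num) ht.le]
    exact Real.rpow_le_rpow (by linarith) (by linarith) (by linarith)

/-! ### The counterexample -/

/-- Wave packets adapted to the anisotropic box defeat `L^p → L^{p'}` boundedness. -/
theorem not_isLpLqBounded {φ : E3 → ℝ} (hφ : IsPhase φ) {N : ℕ} (hN : 2 ≤ N)
    (hO : (fun y : ℝ × ℝ => φ !₂[y.1, y.2, 1] - 1) =O[𝓝 0] fun y => y.2 ^ 2 + |y.1| ^ N)
    {a : E3 → ℂ} (hac : Continuous a) {k R : ℝ}
    (hak : ∀ᶠ y : ℝ × ℝ in 𝓝 0, ∀ t, R ≤ t →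
      a (t • (!₂[y.1, y.2, 1] : E3)) = ((‖t • (!₂[y.1, y.2, 1] : E3)‖ ^ (-k) : ℝ) : ℂ))
    {p : ℝ} (hp : 1 ≤ p) {q : ℝ≥0∞} (hpq : (ENNReal.ofReal p).HolderConjugate q)
    (hk : k < (5 - 2 * (N : ℝ)⁻¹) * (1 / p - 1 / 2)) :
    ¬ IsLpLqBounded φ a (ENNReal.ofReal p) q := by
  intro hb
  have hp0 : 0 < p := by linarith
  have hN0 : (0 : ℝ) < N := by exact_mod_cast (by omega : 0 < N)
  have hpr : (1 / ENNReal.ofReal p).toReal = 1 / p := by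
    simp [hp0.le]
  have hqr : (1 / q).toReal = 1 - 1 / p := by
    have h1 := hpq.inv_add_inv_eq_one
    have h2 : q⁻¹ ≠ ⊤ := by
      intro h; rw [h] at h1; simp at h1
    have h3 : (ENNReal.ofReal p)⁻¹ ≠ ⊤ := by simpa using hp0
    have h4 := congrArg ENNReal.toReal h1
    rw [ENNReal.toReal_add h3 h2, ENNReal.toReal_inv, ENNReal.toReal_ofReal hp0.le] at h4
    simp only [one_div, ENNReal.toReal_one] at h4 ⊢
    linarith
  have hq0 : q ≠ 0 := hpq.symm.ne_zero
  obtain ⟨K, hK⟩ := hb.wavePacket_bound northPole hφ.smooth.continuousOn hac hq0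
  rw [hpr, hqr] at hK
  obtain ⟨C, hC0, hC⟩ := hO.exists_pos
  have hnear : ∀ᶠ y : ℝ × ℝ in 𝓝 0, ‖(!₂[y.1, y.2, 1] : E3)‖ < 2 := by
    have h1 := (continuous_graphPoint (fun _ => 1) (y := 0) continuousAt_const).norm
    refine h1.eventually_lt_const ?_
    simp [EuclideanSpace.norm_eq, Fin.sum_univ_three]
  obtain ⟨ε, hε, hball⟩ := Metric.eventually_nhds_iff_ball.mp ((hC.bound.and hak).and hnear)
  -- The bound `1/2` gives `(2δ)^N ≤ (2δ)²` and keeps the box away from the origin; the bound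
  -- `1/(16C)` makes the phase error `16 C δ²` at most `1/2`.
  set δ : ℝ := min (1 / 2) (1 / (16 * C)) with hδdef
  have hδ : 0 < δ := lt_min (by norm_num) (by positivity)
  have hδ1 : δ ≤ 1 / 2 := min_le_left _ _
  have hδ2 : 16 * C * δ ≤ 1 := by
    have : δ ≤ 1 / (16 * C) := min_le_right _ _
    rw [le_div_iff₀ (by positivity)] at this
    linarith
  clear_value δ
  have hlim : ∀ c : ℝ, 0 < c → ∀ᶠ t : ℝ in atTop, 2 * (δ * t ^ (-c)) < ε := by
    intro c hc
    have h1 : Tendsto (fun t : ℝ => 2 * (δ * t ^ (-c))) atTop (𝓝 (2 * (δ * 0))) :=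
      ((tendsto_rpow_neg_atTop hc).const_mul δ).const_mul 2
    exact h1.eventually_lt_const (by simpa using hε)
  -- The surplus exponent: the test inequality will read `c₁ * t ^ e ≤ K`, which fails for large
  -- `t`.
  set e : ℝ := (5 - 2 * (N : ℝ)⁻¹) * (1 / p - 1 / 2) - k with he
  have he0 : 0 < e := by linarith
  set c₁ : ℝ := 4 ^ (-|k|) * (δ ^ 3) ^ (2 / p - 1) with hc₁
  have hc₁0 : 0 < c₁ := by positivity
  have hgrow : ∀ᶠ t : ℝ in atTop, K < c₁ * t ^ e :=
    ((tendsto_rpow_atTop he0).const_mul_atTop hc₁0).eventually_gt_atTop K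
  -- `t ≥ 2R` ensures `s ≥ t/2 ≥ R`, where `a` has its explicit form; the two limits put the slopes
  -- `y` of the box in the ball of radius `ε`.
  obtain ⟨t, ht1, htR, hte1, hte2, hgt⟩ := ((eventually_ge_atTop (1 : ℝ)).and
    ((eventually_ge_atTop (2 * R)).and ((hlim (N : ℝ)⁻¹ (by positivity)).and
      ((hlim (1 / 2) (by norm_num)).and hgrow)))).exists
  have ht : 0 < t := by linarith
  set A : Fin 3 → ℝ := ![δ * t ^ (1 - (N : ℝ)⁻¹), δ * t ^ (1 / 2 : ℝ), δ * t] with hAdef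
  have hA : ∀ i, 0 < A i := by
    intro i
    fin_cases i <;> simp [hAdef] <;> positivity
  have hA0 : 2 * A 0 / t = 2 * (δ * t ^ (-(N : ℝ)⁻¹)) := by
    have : t ^ (1 - (N : ℝ)⁻¹) = t * t ^ (-(N : ℝ)⁻¹) := by
      rw [sub_eq_add_neg, Real.rpow_add ht, Real.rpow_one]
    simp only [hAdef, Matrix.cons_val_zero, this]
    field_simp
  have hA1 : 2 * A 1 / t = 2 * (δ * t ^ (-(1 / 2) : ℝ)) := by
    have : t ^ (1 / 2 : ℝ) = t * t ^ (-(1 / 2) : ℝ) := by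
      rw [← Real.rpow_one_add' ht.le (by norm_num)]
      norm_num
    simp only [hAdef, Matrix.cons_val_one, Matrix.cons_val_zero, this]
    field_simp
  obtain ⟨L, hLs, hL, hLj⟩ := exists_diagonal hA
  have hbox : ∀ η : E3, ‖η‖ ≤ 1 → ∃ (s : ℝ) (y : ℝ × ℝ),
      t • northPole + L η = s • (!₂[y.1, y.2, 1] : E3) ∧ t / 2 ≤ s ∧ s ≤ 2 * t ∧
      |φ !₂[y.1, y.2, 1] - 1| ≤ C * (8 * δ ^ 2 / t) ∧
      a (s • (!₂[y.1, y.2, 1] : E3)) = ((‖s • (!₂[y.1, y.2, 1] : E3)‖ ^ (-k) : ℝ) : ℂ) ∧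
      ‖(!₂[y.1, y.2, 1] : E3)‖ < 2 := by
    intro η hη
    obtain ⟨s, y, h1, h2, h3, h4, h5⟩ := box_subset_cone hL hA (t := t)
      (by simp only [hAdef, Matrix.cons_val]; nlinarith) hη
    rw [hA0] at h4
    rw [hA1] at h5
    have hy : y ∈ Metric.ball (0 : ℝ × ℝ) ε := by
      rw [mem_ball_zero_iff, Prod.norm_def]
      exact max_lt (h4.trans_lt hte1) (h5.trans_lt hte2)
    obtain ⟨⟨hb1, hb2⟩, hb3⟩ := hball y hy
    refine ⟨s, y, h1, h2, h3, hb1.trans (mul_le_mul_of_nonneg_left ?_ hC0.le), hb2 s (by linarith),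
      hb3⟩
    -- The sides are chosen so that `|y₁|^N` and `y₂²` are both `O(δ²/t)`, which balances the factor
    -- `s ≤ 2t`.
    have h6 : |y.1| ^ N ≤ 4 * δ ^ 2 / t := by
      have h7 : (t ^ (-(N : ℝ)⁻¹)) ^ N = t⁻¹ := by
        rw [← Real.rpow_natCast, ← Real.rpow_mul ht.le, neg_mul, inv_mul_cancel₀ hN0.ne',
          Real.rpow_neg_one]
      have h8 : (2 * δ) ^ N ≤ (2 * δ) ^ 2 :=
        pow_le_pow_of_le_one (by positivity) (by linarith) hN
      calc |y.1| ^ N ≤ (2 * (δ * t ^ (-(N : ℝ)⁻¹))) ^ N := by gcongr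
        _ = (2 * δ) ^ N * t⁻¹ := by rw [← mul_assoc, mul_pow, h7]
        _ ≤ (2 * δ) ^ 2 * t⁻¹ := by gcongr
        _ = 4 * δ ^ 2 / t := by ring
    have h9 : y.2 ^ 2 ≤ 4 * δ ^ 2 / t := by
      have h10 : (t ^ (-(1 / 2) : ℝ)) ^ 2 = t⁻¹ := by
        rw [← Real.rpow_natCast, ← Real.rpow_mul ht.le]
        norm_num
        exact Real.rpow_neg_one t
      calc y.2 ^ 2 = |y.2| ^ 2 := (sq_abs _).symm
        _ ≤ (2 * (δ * t ^ (-(1 / 2) : ℝ))) ^ 2 := by gcongr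
        _ = (2 * δ) ^ 2 * t⁻¹ := by rw [← mul_assoc, mul_pow, h10]
        _ = 4 * δ ^ 2 / t := by ring
    rw [Real.norm_of_nonneg (by positivity)]
    calc y.2 ^ 2 + |y.1| ^ N ≤ 4 * δ ^ 2 / t + 4 * δ ^ 2 / t := add_le_add h9 h6
      _ = 8 * δ ^ 2 / t := by ring
  have hpt : ∀ y : ℝ × ℝ, (!₂[y.1, y.2, 1] : E3) ≠ 0 := by
    intro y h
    have := congrArg (fun x : E3 => x 2) h
    simp at this
  have hmain := hK L (t • northPole) (4 ^ (-|k|) * t ^ (-k)) hLs (by positivity)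
    (by
      intro η hη
      obtain ⟨s, y, h1, h2, -⟩ := hbox η hη
      rw [h1]
      exact smul_ne_zero (by linarith) (hpt y))
    (by
      intro η hη
      obtain ⟨s, y, h1, h2, h3, h4, -⟩ := hbox η hη
      have hs : 0 < s := by linarith
      have hin : inner ℝ (s • (!₂[y.1, y.2, 1] : E3)) northPole = s := by
        simp [northPole, PiLp.inner_apply, Fin.sum_univ_three]
      rw [h1, hin, hφ.homogeneous s hs _ (hpt y), ← mul_sub_one, abs_mul, abs_of_pos hs]
      calc s * |φ !₂[y.1, y.2, 1] - 1| ≤ (2 * t) * (C * (8 * δ ^ 2 / t)) := by gcongr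
        _ = 16 * C * δ * δ := by field_simp; ring
        _ ≤ 1 * (1 / 2) := by gcongr
        _ = 1 / 2 := one_mul _)
    (by
      intro η hη
      obtain ⟨s, y, h1, h2, h3, -, h4, h5⟩ := hbox η hη
      have hs : 0 < s := by linarith
      have h6 : 1 ≤ ‖(!₂[y.1, y.2, 1] : E3)‖ := by
        simpa using PiLp.norm_apply_le (!₂[y.1, y.2, 1] : E3) 2
      refine ⟨_, by rw [h1, h4], rpow_neg_lower ht ?_ ?_⟩
      · rw [norm_smul, Real.norm_of_nonneg hs.le]
        nlinarith
      · rw [norm_smul, Real.norm_of_nonneg hs.le]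
        nlinarith)
  have hJ := jac_pos L
  have hJv : jac L = δ ^ 3 * t ^ (5 / 2 - (N : ℝ)⁻¹) := by
    have h1 : t ^ (5 / 2 - (N : ℝ)⁻¹) = t ^ (1 - (N : ℝ)⁻¹) * t ^ (1 / 2 : ℝ) * t := by
      rw [← Real.rpow_add ht, ← Real.rpow_add_one ht.ne']
      congr 1
      ring
    rw [hLj, h1]
    simp only [hAdef, Matrix.cons_val]
    ring
  have hJp : (jac L) ^ (2 / p - 1)
      = (δ ^ 3) ^ (2 / p - 1) * t ^ ((5 / 2 - (N : ℝ)⁻¹) * (2 / p - 1)) := by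
    rw [hJv, Real.mul_rpow (by positivity) (by positivity), ← Real.rpow_mul ht.le]
  have hfinal : 4 ^ (-|k|) * t ^ (-k) * (jac L) ^ (2 / p - 1) ≤ K := by
    -- Dividing by `J^(-1/p)` leaves the power `1/p - 1/p' = 2/p - 1` of `J`.
    have h1 : (jac L)⁻¹ ^ (1 - 1 / p) = (jac L) ^ (2 / p - 1) * (jac L)⁻¹ ^ (1 / p) := by
      rw [Real.inv_rpow hJ.le, Real.inv_rpow hJ.le, ← Real.rpow_neg hJ.le, ← Real.rpow_neg hJ.le,
        ← Real.rpow_add hJ]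
      congr 1
      ring
    rw [h1, ← mul_assoc] at hmain
    exact le_of_mul_le_mul_right hmain (Real.rpow_pos_of_pos (inv_pos.mpr hJ) _)
  have heq : 4 ^ (-|k|) * t ^ (-k) * (jac L) ^ (2 / p - 1) = c₁ * t ^ e := by
    have h1 : t ^ e = t ^ (-k) * t ^ ((5 / 2 - (N : ℝ)⁻¹) * (2 / p - 1)) := by
      rw [← Real.rpow_add ht, he]
      congr 1
      ring
    rw [hJp, hc₁, h1]
    ring
  linarith

/-! ### Angular localisation and conclusion -/

theorem tendsto_direction : Tendsto
    (fun y : ℝ × ℝ => ‖(!₂[y.1, y.2, 1] : E3)‖⁻¹ • (!₂[y.1, y.2, 1] : E3)) (𝓝 0)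
    (𝓝 northPole) := by
  have h1 := continuous_graphPoint (fun _ => 1) (y := 0) continuousAt_const
  have hn : ‖(!₂[(0 : ℝ), 0, 1] : E3)‖ = 1 := by
    simp [EuclideanSpace.norm_eq, Fin.sum_univ_three]
  have h2 := (h1.norm.inv₀ (by simp [hn])).smul h1
  have h3 : ‖(!₂[(0 : ℝ), 0, 1] : E3)‖⁻¹ • (!₂[(0 : ℝ), 0, 1] : E3) = northPole := by
    rw [hn, inv_one, one_smul, northPole]
  have h4 := h2.tendsto
  rw [← h3]
  exact h4

/-- An amplitude whose angular profile is one near the pole. -/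
theorem exists_amplitude_of_eventually_one (k : ℝ) {θ : E3 → ℝ} (hθ : ContDiff ℝ ∞ θ)
    (hθ1 : ∀ᶠ ξ in 𝓝 northPole, θ ξ = 1) :
    ∃ a : E3 → ℂ, IsAmplitude k a ∧
      (∀ ξ, 1 ≤ ‖ξ‖ → a ξ = ((‖ξ‖ ^ (-k) * θ (‖ξ‖⁻¹ • ξ) : ℝ) : ℂ)) ∧
      (∀ ξ, a ξ ≠ 0 → 1 / 2 ≤ ‖ξ‖ ∧ θ (‖ξ‖⁻¹ • ξ) ≠ 0) ∧
      ∀ᶠ y : ℝ × ℝ in 𝓝 0, ∀ t, (1 : ℝ) ≤ t →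
        a (t • (!₂[y.1, y.2, 1] : E3)) = ((‖t • (!₂[y.1, y.2, 1] : E3)‖ ^ (-k) : ℝ) : ℂ) := by
  obtain ⟨a, ha, hal, has⟩ := exists_amplitude k hθ
  refine ⟨a, ha, hal, has, ?_⟩
  filter_upwards [tendsto_direction.eventually hθ1] with y hy t ht
  have ht0 : 0 < t := by linarith
  have h1 : 1 ≤ ‖(!₂[y.1, y.2, 1] : E3)‖ := by
    simpa using PiLp.norm_apply_le (!₂[y.1, y.2, 1] : E3) 2
  have h2 : ‖t • (!₂[y.1, y.2, 1] : E3)‖ = t * ‖(!₂[y.1, y.2, 1] : E3)‖ := by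
    rw [norm_smul, Real.norm_of_nonneg ht0.le]
  have h3 : ‖t • (!₂[y.1, y.2, 1] : E3)‖⁻¹ • t • (!₂[y.1, y.2, 1] : E3)
      = ‖(!₂[y.1, y.2, 1] : E3)‖⁻¹ • (!₂[y.1, y.2, 1] : E3) := by
    rw [h2, smul_smul]
    congr 1
    field_simp
  rw [hal _ (by rw [h2]; nlinarith), h3, hy, mul_one]

theorem IsConicNhd.exists_profile {Γ : Set E3} (hΓ : IsConicNhd northPole Γ) :
    ∃ θ : E3 → ℝ, ContDiff ℝ ∞ θ ∧ (∀ᶠ ξ in 𝓝 northPole, θ ξ = 1) ∧ tsupport θ ⊆ Γ := by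
  obtain ⟨ρ, hρ, hball⟩ := Metric.isOpen_iff.mp hΓ.isOpen _ hΓ.mem
  let bump : ContDiffBump northPole := ⟨ρ / 4, ρ / 2, by linarith, by linarith⟩
  refine ⟨bump, bump.contDiff, bump.eventuallyEq_one, ?_⟩
  rw [bump.tsupport_eq]
  exact (Metric.closedBall_subset_ball (by linarith : ρ / 2 < ρ)).trans hball

/-- Angular localization inside a cone localizes the support of the amplitude. -/
theorem IsConicNhd.tsupport_subset {v : E3} {Γ : Set E3} (hΓ : IsConicNhd v Γ) {θ : E3 → ℝ}
    (hθ : tsupport θ ⊆ Γ) {a : E3 → ℂ}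
    (ha : ∀ ξ, a ξ ≠ 0 → 1 / 2 ≤ ‖ξ‖ ∧ θ (‖ξ‖⁻¹ • ξ) ≠ 0) : tsupport a ⊆ Γ := by
  intro ξ hξ
  have hn : 1 / 2 ≤ ‖ξ‖ :=
    closure_minimal (fun η hη => (ha η hη).1) (isClosed_le continuous_const continuous_norm) hξ
  have hn0 : 0 < ‖ξ‖ := by linarith
  have hcont : ContinuousAt (fun η : E3 => ‖η‖⁻¹ • η) ξ :=
    (continuous_norm.continuousAt.inv₀ hn0.ne').smul continuousAt_id
  -- The angular projection is continuous at `ξ ≠ 0`, so it carries closure points of the support of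
  -- `a` to closure points of the support of `θ`.
  have hmem : (fun η : E3 => ‖η‖⁻¹ • η) ξ ∈ tsupport θ := by
    refine closure_mono ?_ (mem_closure_image (f := fun η : E3 => ‖η‖⁻¹ • η) hcont hξ)
    rintro _ ⟨η, hη, rfl⟩
    exact (ha η hη).2
  have h1 := hΓ.conic _ (hθ hmem) ‖ξ‖ hn0
  rwa [smul_smul, mul_inv_cancel₀ hn0.ne', one_smul] at h1

end OscConv

theorem theorem2
    (φ : OscConv.E3 → ℝ) (hφ : OscConv.IsPhase φ)
    (ϕ : ℝ × ℝ → ℝ) (hϕ : OscConv.IsLocalGraph φ ϕ)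
    (m n : ℕ∞) (hmn : OscConv.HasNormalForm ϕ m n) (h2m : n ≤ 2 * m) (k : ℝ) :
    (∃ a : OscConv.E3 → ℂ, OscConv.IsAmplitude k a ∧
      (∃ R : ℝ, ∀ ξ : OscConv.E3, R ≤ ‖ξ‖ → a ξ = ((‖ξ‖ ^ (-k) : ℝ) : ℂ)) ∧
      ∀ (p : ℝ) (p' : ℝ≥0∞), 1 ≤ p → p ≤ 2 → (ENNReal.ofReal p).HolderConjugate p' →
        k < OscConv.criticalOrder n p →
          ¬ OscConv.IsLpLqBounded φ a (ENNReal.ofReal p) p') ∧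
    (∀ Γ : Set OscConv.E3, OscConv.IsConicNhd OscConv.northPole Γ →
      ∃ a : OscConv.E3 → ℂ, OscConv.IsAmplitude k a ∧ tsupport a ⊆ Γ ∧
        ∀ (p : ℝ) (p' : ℝ≥0∞), 1 ≤ p → p ≤ 2 → (ENNReal.ofReal p).HolderConjugate p' →
          k < OscConv.criticalOrder n p →
            ¬ OscConv.IsLpLqBounded φ a (ENNReal.ofReal p) p') := by
  have key : ∀ a : OscConv.E3 → ℂ, OscConv.IsAmplitude k a →
      (∀ᶠ y : ℝ × ℝ in nhds 0, ∀ t, (1 : ℝ) ≤ t → a (t • (!₂[y.1, y.2, 1] : OscConv.E3))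
        = ((‖t • (!₂[y.1, y.2, 1] : OscConv.E3)‖ ^ (-k) : ℝ) : ℂ)) →
      ∀ (p : ℝ) (p' : ℝ≥0∞), 1 ≤ p → p ≤ 2 → (ENNReal.ofReal p).HolderConjugate p' →
        k < OscConv.criticalOrder n p →
          ¬ OscConv.IsLpLqBounded φ a (ENNReal.ofReal p) p' := by
    -- For `n = ∞` the integer `N` varies with `p`, but `a` does not involve `N`, so one amplitude
    -- serves all `p`.
    intro a ha hak p p' hp _ hpp hk
    obtain ⟨N, hN2, hNn, hkN⟩ := OscConv.exists_nat_lt_order hmn.2.1 hk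
    exact OscConv.not_isLpLqBounded hφ hN2
      ((hϕ.sub_one_isBigO hφ).trans (hmn.isBigO h2m hNn)) ha.smooth.continuous hak hp hpp hkN
  refine ⟨?_, fun Γ hΓ => ?_⟩
  · obtain ⟨a, ha, hal, -, hak⟩ := OscConv.exists_amplitude_of_eventually_one k
      (θ := fun _ => 1) contDiff_const (Filter.Eventually.of_forall fun _ => rfl)
    exact ⟨a, ha, ⟨1, fun ξ hξ => by simpa using hal ξ hξ⟩, key a ha hak⟩
  · obtain ⟨θ, hθ, hθ1, hθs⟩ := hΓ.exists_profile
    obtain ⟨a, ha, -, has, hak⟩ := OscConv.exists_amplitude_of_eventually_one k hθ hθ1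
    exact ⟨a, ha, hΓ.tsupport_subset hθs has, key a ha hak⟩
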